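/- All matroids are finite. For a matroid $L$ on a ground set $E$ and $X\subseteq E$, let $L|X$ be the restriction of $L$ to $X$, and let $L.X = L/(E\setminus X)$ be the contraction of $L$ to $X$. Two matroids $M$ on $A$ and $N$ on $B$ (where $A$ and $B$ may intersect) are *matched* if $M.(A\cap B)=N|(A\cap B)$. In this case a *splice* of $M$ and $N$ is a matroid $L$ on $A\cup B$ such that $L|A=M$ and $L.B=N$. Proposition 7.1. Let $F$ be a field with two or three elements, that is, $F\in\{\mathrm{GF}(2),\mathrm{GF}(3)\}$. If the matched matroids $M$ and $N$ are both representable over $F$, then some splice of $M$ and $N$ is representable over $F$. -/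

import Mathlib

namespace MatroidSplice

/-- The contraction `M.X` of the matroid `M` *to* the set `X`, that is, the matroid obtained by
contracting all elements of the ground set outside `X`. If `X ⊆ M.E`, its ground set is `X`. -/
def contractTo {α : Type*} (M : Matroid α) (X : Set α) : Matroid α :=
  M.contract (M.E \ X)

/-- The ordered pair `(M, N)` of matroids, on ground sets `A` and `B`, is matched if
`M.(A ∩ B) = N|(A ∩ B)`. -/
def Matched {α : Type*} (M N : Matroid α) : Prop :=
  contractTo M (M.E ∩ N.E) = N.restrict (M.E ∩ N.E)

/-- A splice of `M` and `N`, on ground sets `A` and `B`, is a matroid `L` on `A ∪ B` with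
`L|A = M` and `L.B = N`. -/
structure IsSplice {α : Type*} (L M N : Matroid α) : Prop where
  ground_eq : L.E = M.E ∪ N.E
  restrict_eq : L.restrict M.E = M
  contractTo_eq : contractTo L N.E = N

/-- A matroid is representable over `F` if there is a matrix over `F` with finitely many rows,
whose columns are labelled by the elements of the ground set, such that a subset of the ground
set is independent exactly when the columns it labels form a linearly independent family. -/
def IsRepresentable {α : Type*} (F : Type*) [Field F] (M : Matroid α) : Prop :=
  ∃ (r : ℕ) (P : Matrix (Fin r) M.E F),
    ∀ I : Set M.E, M.Indep ((fun e : M.E => (e : α)) '' I) ↔ LinearIndepOn F P.col I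

end MatroidSplice

/-! Let `v` represent `M` on A and `w` represent `N` on B. Modulo the span U of `v` on A \ B, the
family `v` has the same independent sets on A ∩ B as `w`, because the matroids are matched. Over
GF(2) and GF(3) representations are unique up to scaling (`exists_units_forall_relation_iff`), so
`w` can be rescaled by `c` to have the same relations on A ∩ B as `v` mod U. With `g` a projection
onto U, the vectors `(g (v e), c e • w e)` represent a splice (`exists_isSplice_of_represents`).

Uniqueness is proved one element at a time. If u and w lie in the same spans of subfamilies, each
elementary functional takes values on u and w that are equal up to sign, so it kills u + w or u - w.
Hence these two vectors are not linked and lie in complementary subspaces that together contain the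
family. The map that is 1 on one and -1 on the other takes u to w. -/

namespace MatroidSplice

open Module Submodule

/-! ### Functionals of minimal support and connectedness -/

section Elementary

variable {F V ι : Type*} [Field F] [AddCommGroup V] [Module F V]

open Classical in
/-- The indices in `s` of the vectors of the family `v` at which `f` does not vanish. -/
noncomputable def dualSupport (v : ι → V) (s : Finset ι) (f : Dual F V) : Finset ι :=
  s.filter fun i => f (v i) ≠ 0

/-- A nonzero functional is elementary if it is determined, up to a scalar, by its support. The
supports of the elementary functionals are the cocircuits of the family `v`. -/
def IsElementary (v : ι → V) (s : Finset ι) (f : Dual F V) : Prop :=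
  f ≠ 0 ∧ ∀ g : Dual F V, dualSupport v s g ⊆ dualSupport v s f → ∃ a : F, g = a • f

theorem mem_dualSupport {v : ι → V} {s : Finset ι} {f : Dual F V} {i : ι} :
    i ∈ dualSupport v s f ↔ i ∈ s ∧ f (v i) ≠ 0 := by
  classical simp [dualSupport]

theorem exists_mem_dualSupport {v : ι → V} {s : Finset ι} (hs : span F (v '' s) = ⊤)
    {f : Dual F V} (hf : f ≠ 0) : ∃ i, i ∈ dualSupport v s f := by
  by_contra! h
  apply hf
  refine LinearMap.ext_on hs ?_
  rintro _ ⟨i, hi, rfl⟩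
  by_contra hne
  exact h i (mem_dualSupport.2 ⟨hi, hne⟩)

/-- A functional killing the right side has support inside that of `f`, so it is a multiple of `f`
and cannot separate a point of `ker f` from that span. -/
theorem IsElementary.ker_eq_span {v : ι → V} {s : Finset ι} {f : Dual F V}
    (hf : IsElementary v s f) :
    LinearMap.ker f = span F (v '' {i | i ∈ s ∧ f (v i) = 0}) := by
  apply le_antisymm
  · intro u hu
    by_contra hn
    obtain ⟨g, hgu, hg⟩ := Submodule.exists_le_ker_of_notMem hn
    obtain ⟨a, rfl⟩ := hf.2 g (by
      intro i hi
      rw [mem_dualSupport] at hi ⊢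
      refine ⟨hi.1, fun h0 => hi.2 ?_⟩
      exact hg (subset_span ⟨i, ⟨hi.1, h0⟩, rfl⟩))
    apply hgu
    simp [LinearMap.mem_ker.1 hu]
  · rw [span_le]
    rintro _ ⟨i, hi, rfl⟩
    exact hi.2

/-- Subtracting a multiple of `h` to kill the value at an element of both supports. -/
theorem dualSupport_sub_smul {v : ι → V} {s : Finset ι} {f g : Dual F V} {i : ι}
    (hg : g (v i) ≠ 0) :
    (f - (f (v i) / g (v i)) • g) (v i) = 0 ∧
      ∀ j ∈ dualSupport v s (f - (f (v i) / g (v i)) • g),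
        j ∈ dualSupport v s f ∨ j ∈ dualSupport v s g := by
  constructor
  · simp [hg]
  · intro j hj
    simp only [mem_dualSupport] at hj ⊢
    by_contra! hn
    apply hj.2
    simp [hn.1 hj.1, hn.2 hj.1]

theorem exists_isElementary {v : ι → V} {s : Finset ι} (hs : span F (v '' s) = ⊤) (p : V)
    (g : Dual F V) (hg : g p ≠ 0) :
    ∃ f : Dual F V, IsElementary v s f ∧ dualSupport v s f ⊆ dualSupport v s g ∧ f p ≠ 0 := by
  induction hn : (dualSupport v s g).card using Nat.strong_induction_on generalizing g with
  | _ n ih =>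
  have step : ∀ g' : Dual F V, g' p ≠ 0 → dualSupport v s g' ⊂ dualSupport v s g →
      ∃ f : Dual F V, IsElementary v s f ∧ dualSupport v s f ⊆ dualSupport v s g ∧ f p ≠ 0 := by
    intro g' hg' hss
    obtain ⟨f, hf, hfs, hfp⟩ := ih _ (hn ▸ Finset.card_lt_card hss) g' hg' rfl
    exact ⟨f, hf, hfs.trans hss.subset, hfp⟩
  by_cases hel : IsElementary v s g
  · exact ⟨g, hel, subset_rfl, hg⟩
  have hg0 : g ≠ 0 := fun h => hg (by simp [h])
  simp only [IsElementary, hg0, ne_eq, not_false_eq_true, true_and, not_forall, not_exists] at hel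
  obtain ⟨h, hsub, hprop⟩ := hel
  have hh0 : h ≠ 0 := fun h0 => hprop 0 (by simp [h0])
  obtain ⟨i, hi⟩ := exists_mem_dualSupport hs hh0
  have hig := hsub hi
  have hiv := (mem_dualSupport.1 hi).2
  obtain ⟨hz, hsup⟩ := dualSupport_sub_smul (s := s) (f := g) hiv
  set g' := g - (g (v i) / h (v i)) • h with hg'
  have hss : dualSupport v s g' ⊂ dualSupport v s g := by
    refine ⟨fun j hj => (hsup j hj).elim id (fun k => hsub k), fun hle => ?_⟩
    exact (mem_dualSupport.1 (hle hig)).2 hz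
  -- If `g'` vanishes at `p`, then `h` does not; subtracting a multiple of `g'` from `h` keeps the
  -- value at `p` and shrinks the support.
  by_cases hp : g' p = 0
  · have hgi := (mem_dualSupport.1 hig).2
    have hg'0 : g' ≠ 0 := by
      intro h0
      apply hprop (h (v i) / g (v i))
      rw [hg', sub_eq_zero] at h0
      rw [h0, smul_smul]
      simp [← h0, hgi, hiv]
    obtain ⟨j, hj⟩ := exists_mem_dualSupport hs hg'0
    have hjv := (mem_dualSupport.1 hj).2
    obtain ⟨hz', hsup'⟩ := dualSupport_sub_smul (s := s) (f := h) hjv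
    have hhp : h p ≠ 0 := by
      intro h0
      apply hg
      simpa [hg', h0] using hp
    refine step (h - (h (v j) / g' (v j)) • g') (by simp [hp, hhp])
      ⟨fun k hk => (hsup' k hk).elim (fun k => hsub k) (fun k => hss.subset k), fun hle => ?_⟩
    exact (mem_dualSupport.1 (hle (hss.subset hj))).2 hz'
  · exact step g' hp hss

/-- Some elementary functional vanishes neither at `p` nor at `q`. -/
def Linked (v : ι → V) (s : Finset ι) (p q : V) : Prop :=
  ∃ f : Dual F V, IsElementary v s f ∧ f p ≠ 0 ∧ f q ≠ 0

/-- Being linked is transitive through the vectors of the family. -/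
theorem linked_trans {v : ι → V} {s : Finset ι} (hs : span F (v '' s) = ⊤) {p q : V} {i : ι}
    (hi : i ∈ s) (hp : Linked (F := F) v s p (v i)) (hq : Linked (F := F) v s (v i) q) :
    Linked (F := F) v s p q := by
  classical
  obtain ⟨f, hf, hfp, hfi⟩ := hp
  obtain ⟨g, hg, hgi, hgq⟩ := hq
  induction hn : (dualSupport v s f ∪ dualSupport v s g).card using Nat.strong_induction_on
    generalizing f g i with
  | _ n ih =>
  by_cases hfq : f q = 0
  swap
  · exact ⟨f, hf, hfp, hfq⟩
  by_cases hgp : g p = 0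
  swap
  · exact ⟨g, hg, hgp, hgq⟩
  obtain ⟨hz, hsup⟩ := dualSupport_sub_smul (s := s) (f := f) hgi
  obtain ⟨h₁, he₁, hs₁, hp₁⟩ := exists_isElementary hs p (f - (f (v i) / g (v i)) • g)
    (by simp [hgp, hfp])
  obtain ⟨hz', hsup'⟩ := dualSupport_sub_smul (s := s) (f := g) hfi
  obtain ⟨h₂, he₂, hs₂, hq₂⟩ := exists_isElementary hs q (g - (g (v i) / f (v i)) • f)
    (by simp [hfq, hgq])
  have hi₁ : i ∉ dualSupport v s h₁ := fun h => (mem_dualSupport.1 (hs₁ h)).2 hz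
  have hi₂ : i ∉ dualSupport v s h₂ := fun h => (mem_dualSupport.1 (hs₂ h)).2 hz'
  -- A functional vanishing at `v i` is no nonzero multiple of `f`, so its support leaves that of
  -- `f`.
  have key : ∀ (f h : Dual F V) (r : V), IsElementary v s f → i ∉ dualSupport v s h →
      i ∈ dualSupport v s f → h r ≠ 0 → ¬ dualSupport v s h ⊆ dualSupport v s f := by
    intro f h r hf hi hif hr hsub
    obtain ⟨a, rfl⟩ := hf.2 h hsub
    have ha : a ≠ 0 := by rintro rfl; simp at hr
    rw [mem_dualSupport] at hi hif
    exact hi ⟨hif.1, by simp [ha, hif.2]⟩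
  obtain ⟨j, hj₁, hjf⟩ := Finset.not_subset.1
    (key f h₁ p hf hi₁ (mem_dualSupport.2 ⟨hi, hfi⟩) hp₁)
  obtain ⟨k, hk₂, hkg⟩ := Finset.not_subset.1
    (key g h₂ q hg hi₂ (mem_dualSupport.2 ⟨hi, hgi⟩) hq₂)
  have hjg : j ∈ dualSupport v s g := (hsup j (hs₁ hj₁)).resolve_left hjf
  have hkf : k ∈ dualSupport v s f := (hsup' k (hs₂ hk₂)).resolve_left hkg
  have hsub₁ : dualSupport v s h₁ ⊆ dualSupport v s f ∪ dualSupport v s g :=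
    fun l hl => Finset.mem_union.2 (hsup l (hs₁ hl))
  have hsub₂ : dualSupport v s h₂ ⊆ dualSupport v s f ∪ dualSupport v s g :=
    fun l hl => Finset.mem_union.2 (hsup' l (hs₂ hl)).symm
  -- Either `h₁`, `g` meet at `j` with a smaller union of supports, or `k` lies in the support of
  -- `h₁`; then `h₁`, `h₂` meet at `k` and their union misses `i`.
  by_cases hlt : dualSupport v s h₁ ∪ dualSupport v s g ⊂ dualSupport v s f ∪ dualSupport v s g
  · exact ih _ (hn ▸ Finset.card_lt_card hlt) (mem_dualSupport.1 hj₁).1 h₁ he₁ hp₁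
      (mem_dualSupport.1 hj₁).2 g hg (mem_dualSupport.1 hjg).2 hgq rfl
  · have hk₁ : k ∈ dualSupport v s h₁ := by
      by_contra hk₁
      refine hlt ⟨Finset.union_subset hsub₁ Finset.subset_union_right, fun hle => ?_⟩
      have := hle (Finset.mem_union_left _ hkf)
      exact (Finset.mem_union.1 this).elim hk₁ hkg
    refine ih _ (hn ▸ Finset.card_lt_card (s := dualSupport v s h₁ ∪ dualSupport v s h₂)
      ⟨Finset.union_subset hsub₁ hsub₂, fun hle => ?_⟩)
      (mem_dualSupport.1 hk₁).1 h₁ he₁ hp₁ (mem_dualSupport.1 hk₁).2 h₂ he₂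
      (mem_dualSupport.1 hk₂).2 hq₂ rfl
    have := hle (Finset.mem_union_left _ (mem_dualSupport.2 ⟨hi, hfi⟩))
    exact (Finset.mem_union.1 this).elim hi₁ hi₂

/-- Two vectors that are not linked lie in complementary subspaces whose union contains all
vectors of the family. -/
theorem exists_isCompl_of_not_linked {v : ι → V} {s : Finset ι} (hs : span F (v '' s) = ⊤)
    {p q : V} (hpq : ¬ Linked (F := F) v s p q) :
    ∃ P Q : Submodule F V, IsCompl P Q ∧ p ∈ P ∧ q ∈ Q ∧ ∀ i ∈ s, v i ∈ P ∨ v i ∈ Q := by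
  have symm : ∀ {x y : V}, Linked (F := F) v s x y → Linked (F := F) v s y x :=
    fun ⟨f, hf, hx, hy⟩ => ⟨f, hf, hy, hx⟩
  set P := span F (v '' {i | i ∈ s ∧ Linked (F := F) v s (v i) p}) with hP
  set Q := span F (v '' {i | i ∈ s ∧ ¬ Linked (F := F) v s (v i) p}) with hQ
  have vanish : ∀ (T : Set ι) (f : Dual F V), (∃ x ∈ span F (v '' T), f x ≠ 0) →
      ∃ i ∈ T, f (v i) ≠ 0 := by
    rintro T f ⟨x, hx, hfx⟩
    by_contra! h
    have : span F (v '' T) ≤ LinearMap.ker f := by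
      rw [span_le]
      rintro _ ⟨i, hi, rfl⟩
      exact h i hi
    exact hfx (this hx)
  -- Otherwise `f` would link a family vector linked to `p` with one that is not.
  have excl : ∀ f : Dual F V, IsElementary v s f → ∀ x ∈ P, ∀ y ∈ Q, f x ≠ 0 → f y = 0 := by
    intro f hf x hx y hy hfx
    by_contra hfy
    obtain ⟨i, hi, hfi⟩ := vanish _ f ⟨x, hx, hfx⟩
    obtain ⟨j, hj, hfj⟩ := vanish _ f ⟨y, hy, hfy⟩
    exact hj.2 (linked_trans hs hi.1 ⟨f, hf, hfj, hfi⟩ hi.2)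
  have sep : ∀ x : V, x ≠ 0 → ∃ f : Dual F V, IsElementary v s f ∧ f x ≠ 0 := by
    intro x hx
    obtain ⟨g, hg⟩ := not_forall.1 (mt (Module.forall_dual_apply_eq_zero_iff F x).1 hx)
    obtain ⟨f, hf, -, hfx⟩ := exists_isElementary hs x g hg
    exact ⟨f, hf, hfx⟩
  have hcases : ∀ i ∈ s, v i ∈ P ∨ v i ∈ Q := by
    intro i hi
    by_cases h : Linked (F := F) v s (v i) p
    · exact Or.inl (subset_span ⟨i, ⟨hi, h⟩, rfl⟩)
    · exact Or.inr (subset_span ⟨i, ⟨hi, h⟩, rfl⟩)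
  have htop : P ⊔ Q = ⊤ := by
    rw [eq_top_iff, ← hs, span_le]
    rintro _ ⟨i, hi, rfl⟩
    exact (hcases i hi).elim (fun h => mem_sup_left h) (fun h => mem_sup_right h)
  refine ⟨P, Q, ⟨?_, codisjoint_iff.2 htop⟩, ?_, ?_, hcases⟩
  · rw [Submodule.disjoint_def]
    intro x hxP hxQ
    by_contra hx
    obtain ⟨f, hf, hfx⟩ := sep x hx
    exact hfx (excl f hf x hxP x hxQ hfx)
  · obtain ⟨x, hx, y, hy, hxy⟩ := mem_sup.1 (htop ▸ mem_top : p ∈ P ⊔ Q)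
    by_cases hy0 : y = 0
    · simpa [← hxy, hy0] using hx
    obtain ⟨f, hf, hfy⟩ := sep y hy0
    have hfx : f x = 0 := by
      by_contra hfx
      exact hfy (excl f hf x hx y hy hfx)
    obtain ⟨i, hi, hfi⟩ := vanish _ f ⟨y, hy, hfy⟩
    exact absurd ⟨f, hf, hfi, by simpa [← hxy, hfx] using hfy⟩ hi.2
  · obtain ⟨x, hx, y, hy, hxy⟩ := mem_sup.1 (htop ▸ mem_top : q ∈ P ⊔ Q)
    by_cases hx0 : x = 0
    · simpa [← hxy, hx0] using hy
    obtain ⟨f, hf, hfx⟩ := sep x hx0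
    have hfy : f y = 0 := excl f hf x hx y hy hfx
    obtain ⟨i, hi, hfi⟩ := vanish _ f ⟨x, hx, hfx⟩
    exact absurd (linked_trans hs hi.1 (symm hi.2)
      ⟨f, hf, hfi, by simpa [← hxy, hfy] using hfx⟩) hpq

/-- Over a field with two or three elements, if `u` and `w` lie in the same spans of subfamilies
of a spanning family, then some automorphism takes `u` to a multiple of `w` and every vector of
the family to a multiple of itself. -/
theorem exists_diagonal_map (hF : ∀ x : F, x = 0 ∨ x = 1 ∨ x = -1) {v : ι → V} {s : Finset ι}
    (hs : span F (v '' s) = ⊤) {u w : V}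
    (huw : ∀ I : Set ι, I ⊆ s → (u ∈ span F (v '' I) ↔ w ∈ span F (v '' I))) :
    ∃ (T : V →ₗ[F] V) (c : ι → Fˣ), Function.Injective T ∧ (∀ i ∈ s, T (v i) = c i • v i) ∧
      T u = w := by
  have hker : ∀ f : Dual F V, IsElementary v s f → (f u = 0 ↔ f w = 0) := by
    intro f hf
    rw [← LinearMap.mem_ker, ← LinearMap.mem_ker, hf.ker_eq_span]
    exact huw _ fun i hi => hi.1
  have hlink : ¬ Linked (F := F) v s (u + w) (u - w) := by
    rintro ⟨f, hf, hp, hq⟩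
    have h0 := hker f hf
    simp only [map_add, map_sub] at hp hq
    rcases hF (f u) with h | h | h <;> rcases hF (f w) with h' | h' | h' <;>
      simp_all
  -- In characteristic 2, `u + w = u - w`, and only the zero vector is not linked to itself.
  by_cases h2 : (2 : F) = 0
  · have huw' : u = w := by
      rw [← sub_eq_zero]
      by_contra hne
      obtain ⟨g, hg⟩ := not_forall.1 (mt (Module.forall_dual_apply_eq_zero_iff F (u - w)).1 hne)
      obtain ⟨f, hf, -, hfx⟩ := exists_isElementary hs (u - w) g hg
      refine hlink ⟨f, hf, ?_, hfx⟩
      have : u + w = (u - w) + (2 : F) • w := by rw [two_smul]; abel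
      rwa [this, h2, zero_smul, add_zero]
    exact ⟨LinearMap.id, fun _ => 1, fun _ _ h => h, by simp, huw'⟩
  obtain ⟨P, Q, hc, hp, hq, hv⟩ := exists_isCompl_of_not_linked hs hlink
  set T := LinearMap.ofIsCompl hc P.subtype (-Q.subtype) with hT
  have hTP : ∀ x ∈ P, T x = x := fun x hx => by
    simpa using LinearMap.ofIsCompl_apply_left hc (φ := P.subtype) (ψ := -Q.subtype) ⟨x, hx⟩
  have hTQ : ∀ x ∈ Q, T x = -x := fun x hx => by
    simpa using LinearMap.ofIsCompl_apply_right hc (φ := P.subtype) (ψ := -Q.subtype) ⟨x, hx⟩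
  have hTT : ∀ x, T (T x) = x := by
    intro x
    obtain ⟨y, hy, z, hz, rfl⟩ := mem_sup.1 (hc.sup_eq_top ▸ mem_top : x ∈ P ⊔ Q)
    simp [hTP y hy, hTQ z hz]
  classical
  refine ⟨T, fun i => if v i ∈ P then 1 else -1, fun x y h => ?_, fun i hi => ?_, ?_⟩
  · rw [← hTT x, h, hTT]
  · dsimp only
    split_ifs with h
    · simp [hTP _ h]
    · simp [hTQ _ ((hv i hi).resolve_left h)]
  · have h : T ((u + w) + (u - w)) = (u + w) + -(u - w) := by
      rw [map_add, hTP _ hp, hTQ _ hq]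
    have h' : (2 : F) • T u = (2 : F) • w := by
      rw [← map_smul, two_smul, two_smul, show u + u = (u + w) + (u - w) by abel, h]
      abel
    exact smul_right_injective V h2 h'

end Elementary

/-! ### Unique representability -/

section Uniqueness

variable {F V W ι : Type*} [Field F] [AddCommGroup V] [Module F V] [AddCommGroup W] [Module F W]

theorem mem_span_image_finset_iff {v : ι → V} {s : Finset ι} {x : V} :
    x ∈ span F (v '' s) ↔ ∃ a : ι → F, ∑ i ∈ s, a i • v i = x := by
  classical
  rw [mem_span_image_finset_iff_exists_fun]
  constructor
  · rintro ⟨a, rfl⟩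
    refine ⟨fun i => if h : i ∈ s then a ⟨i, h⟩ else 0, ?_⟩
    rw [← Finset.sum_coe_sort]
    exact Finset.sum_congr rfl fun i _ => by simp
  · rintro ⟨a, rfl⟩
    exact ⟨fun i => a i, Finset.sum_coe_sort s fun i => a i • v i⟩

/-- Take a maximal `v`-independent `J ⊆ I`: if `w i` avoided the span of `w` on `J`, adding `i`
would keep `J` independent for `w`, hence for `v`. -/
theorem mem_span_image_of_linearIndepOn_iff {v : ι → V} {w : ι → W} {s : Set ι}
    (h : ∀ I ⊆ s, LinearIndepOn F v I ↔ LinearIndepOn F w I) {I : Set ι} (hI : I ⊆ s) {i : ι}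
    (hi : i ∈ s) (hv : v i ∈ span F (v '' I)) : w i ∈ span F (w '' I) := by
  by_contra hw
  obtain ⟨J, hJI, -, hspan, hJ⟩ :=
    exists_linearIndepOn_extension (linearIndepOn_empty F v) (Set.empty_subset I)
  have hwJ : w i ∉ span F (w '' J) := fun hm => hw (span_mono (Set.image_mono hJI) hm)
  have hins := ((h J (hJI.trans hI)).1 hJ).notMem_span_iff.1 hwJ
  have := (h _ (Set.insert_subset hi (hJI.trans hI))).2 hins.1
  exact ((linearIndepOn_insert hins.2).1 this).2 (span_le.2 hspan hv)

theorem linearIndepOn_units_smul_iff {v : ι → V} (c : ι → Fˣ) {I : Set ι} :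
    LinearIndepOn F (fun i => c i • v i) I ↔ LinearIndepOn F v I := by
  constructor
  · intro h
    have : LinearIndepOn F (fun i => (c i)⁻¹ • c i • v i) I :=
      LinearIndependent.units_smul h fun i : I => (c i)⁻¹
    simpa using this
  · intro h
    exact LinearIndependent.units_smul h fun i : I => c i

/-- A version of `exists_diagonal_map` for families that need not span the space. -/
theorem exists_units_relation_iff (hF : ∀ x : F, x = 0 ∨ x = 1 ∨ x = -1) {v : ι → V}
    {s : Finset ι} {u w : V} (hu : u ∈ span F (v '' s)) (hw : w ∈ span F (v '' s))
    (huw : ∀ I : Set ι, I ⊆ s → (u ∈ span F (v '' I) ↔ w ∈ span F (v '' I))) :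
    ∃ c : ι → Fˣ, ∀ (a : ι → F) (b : F),
      b • u + ∑ i ∈ s, a i • v i = 0 ↔ b • w + ∑ i ∈ s, a i • c i • v i = 0 := by
  classical
  set S := span F (v '' s) with hS
  let v' : ι → S := fun i => if h : i ∈ s then ⟨v i, subset_span ⟨i, h, rfl⟩⟩ else 0
  have hv' : ∀ i ∈ s, (v' i : V) = v i := fun i hi => by simp [v', hi]
  have hmem : ∀ I : Set ι, I ⊆ s → ∀ x : S,
      x ∈ span F (v' '' I) ↔ (x : V) ∈ span F (v '' I) := by
    intro I hI x
    have : v '' I = S.subtype '' (v' '' I) := by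
      rw [Set.image_image]
      exact Set.image_congr fun i hi => (hv' i (hI hi)).symm
    rw [this, ← Submodule.map_span]
    simp
  have htop : span F (v' '' s) = ⊤ := by
    rw [eq_top_iff]
    rintro x -
    rw [hmem _ subset_rfl]
    exact x.2
  obtain ⟨T, c, hT, hTv, hTu⟩ := exists_diagonal_map hF htop (u := ⟨u, hu⟩) (w := ⟨w, hw⟩)
    (fun I hI => by rw [hmem I hI, hmem I hI]; exact huw I hI)
  refine ⟨c, fun a b => ?_⟩
  have h₁ : b • u + ∑ i ∈ s, a i • v i =
      ((b • (⟨u, hu⟩ : S) + ∑ i ∈ s, a i • v' i : S) : V) := by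
    push_cast
    congr 1
    exact Finset.sum_congr rfl fun i hi => by rw [hv' i hi]
  have h₂ : b • w + ∑ i ∈ s, a i • c i • v i =
      ((T (b • (⟨u, hu⟩ : S) + ∑ i ∈ s, a i • v' i) : S) : V) := by
    rw [map_add, map_smul, hTu, map_sum]
    push_cast
    congr 1
    refine Finset.sum_congr rfl fun i hi => ?_
    rw [map_smul, hTv i hi, ← hv' i hi]
    rfl
  rw [h₁, h₂, ZeroMemClass.coe_eq_zero, ZeroMemClass.coe_eq_zero, map_eq_zero_iff T hT]

theorem eq_zero_of_smul_add_eq_zero {S : Submodule F V} {x y : V} {a : F} (hx : x ∉ S)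
    (hy : y ∈ S) (h : a • x + y = 0) : a = 0 := by
  by_contra ha
  apply hx
  rw [← S.smul_mem_iff ha, eq_neg_of_add_eq_zero_left h]
  exact S.neg_mem hy

theorem sum_smul_sub_sum_smul [DecidableEq ι] {I s : Finset ι} (hI : I ⊆ s) (a b : ι → F)
    (v : ι → V) : ∑ i ∈ I, a i • v i - ∑ i ∈ s, b i • v i =
      ∑ i ∈ s, ((if i ∈ I then a i else 0) - b i) • v i := by
  simp only [sub_smul, Finset.sum_sub_distrib, ite_smul, zero_smul]
  rw [Finset.sum_ite_mem, Finset.inter_eq_right.2 hI]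

/-- Unique representability: over a field with two or three elements, two finite families with
the same independent subfamilies have the same linear relations after rescaling. -/
theorem exists_units_forall_relation_iff (hF : ∀ x : F, x = 0 ∨ x = 1 ∨ x = -1) {v : ι → V}
    {w : ι → W} (s : Finset ι)
    (h : ∀ I : Set ι, I ⊆ s → (LinearIndepOn F v I ↔ LinearIndepOn F w I)) :
    ∃ c : ι → Fˣ, ∀ a : ι → F,
      ∑ i ∈ s, a i • c i • v i = 0 ↔ ∑ i ∈ s, a i • w i = 0 := by
  classical
  induction s using Finset.induction_on with
  | empty => exact ⟨1, by simp⟩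
  | insert e s he ih =>
  obtain ⟨c, hc⟩ := ih fun I hI => h I (hI.trans (by simp))
  set v' : ι → V := fun i => c i • v i with hv'
  have hmem : ∀ I : Set ι, I ⊆ s → (v' e ∈ span F (v' '' I) ↔ w e ∈ span F (w '' I)) := by
    have h' : ∀ I : Set ι, I ⊆ ((insert e s : Finset ι) : Set ι) →
        (LinearIndepOn F v' I ↔ LinearIndepOn F w I) := fun I hI => by
      rw [linearIndepOn_units_smul_iff, h I hI]
    intro I hI
    have hI' : I ⊆ ((insert e s : Finset ι) : Set ι) := hI.trans (by simp)
    exact ⟨mem_span_image_of_linearIndepOn_iff h' hI' (by simp),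
      mem_span_image_of_linearIndepOn_iff (fun I hI => (h' I hI).symm) hI' (by simp)⟩
  have hsum : ∀ a : ι → F, ∑ i ∈ s, a i • v' i ∈ span F (v' '' s) := fun a =>
    sum_mem fun i hi => smul_mem _ _ (subset_span ⟨i, hi, rfl⟩)
  have hsumw : ∀ a : ι → F, ∑ i ∈ s, a i • w i ∈ span F (w '' s) := fun a =>
    sum_mem fun i hi => smul_mem _ _ (subset_span ⟨i, hi, rfl⟩)
  -- Outside the span, `e` has coefficient 0 in every relation.
  by_cases hve : v' e ∈ span F (v' '' s)
  swap
  · have hwe : w e ∉ span F (w '' s) := fun hn => hve ((hmem s subset_rfl).2 hn)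
    refine ⟨c, fun a => ?_⟩
    rw [Finset.sum_insert he, Finset.sum_insert he]
    constructor <;> intro ha
    · have h0 := eq_zero_of_smul_add_eq_zero hve (hsum a) ha
      simp only [h0, zero_smul, zero_add] at ha ⊢
      exact (hc a).1 ha
    · have h0 := eq_zero_of_smul_add_eq_zero hwe (hsumw a) ha
      simp only [h0, zero_smul, zero_add] at ha ⊢
      exact (hc a).2 ha
  obtain ⟨b, hb⟩ := mem_span_image_finset_iff.1 ((hmem s subset_rfl).1 hve)
  -- The coefficients expressing `w e` are transported to `v'`; the result lies in the same spans as
  -- `v' e`.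
  have htrans : ∀ I : Set ι, I ⊆ s →
      (w e ∈ span F (w '' I) ↔ ∑ i ∈ s, b i • v' i ∈ span F (v' '' I)) := by
    intro I hI
    lift I to Finset ι using s.finite_toSet.subset hI
    rw [mem_span_image_finset_iff, mem_span_image_finset_iff, ← hb]
    refine exists_congr fun a => ?_
    have hI' : I ⊆ s := by exact_mod_cast hI
    rw [← sub_eq_zero, sum_smul_sub_sum_smul hI', ← hc, ← sub_eq_zero (b := ∑ i ∈ s, b i • v' i),
      sum_smul_sub_sum_smul hI']
  obtain ⟨d, hd⟩ := exists_units_relation_iff hF hve (hsum b)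
    (fun I hI => (hmem I hI).trans (htrans I hI))
  refine ⟨fun i => if i = e then c e else (d i)⁻¹ * c i, fun a => ?_⟩
  have hsum_eq : ∑ i ∈ s, a i • (if i = e then c e else (d i)⁻¹ * c i) • v i =
      ∑ i ∈ s, (a i * ((d i)⁻¹ : Fˣ)) • v' i := by
    refine Finset.sum_congr rfl fun i hi => ?_
    rw [if_neg (by rintro rfl; exact he hi), hv', mul_smul, mul_smul]
    rfl
  have hd_eq : ∑ i ∈ s, (a i * ((d i)⁻¹ : Fˣ)) • d i • v' i = ∑ i ∈ s, a i • v' i := by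
    refine Finset.sum_congr rfl fun i _ => ?_
    rw [Units.smul_def, smul_smul, mul_assoc, Units.inv_mul, mul_one]
  have hcomb := hc fun i => a e * b i + a i
  simp only [add_smul, mul_smul, Finset.sum_add_distrib, ← Finset.smul_sum] at hcomb
  rw [Finset.sum_insert he, Finset.sum_insert he, hsum_eq]
  simp only [if_true]
  rw [← hb, ← hcomb, hd, hd_eq]

end Uniqueness

/-! ### Vector families and matroids -/

section Representation

variable {F V W α : Type*} [Field F] [AddCommGroup V] [Module F V] [AddCommGroup W] [Module F W]

/-- The family `v` represents `M`; the elements outside the ground set are sent to vectors that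
belong to no independent subfamily. -/
def Represents (F : Type*) [Field F] [Module F V] (v : α → V) (M : Matroid α) : Prop :=
  ∀ I : Set α, M.Indep I ↔ LinearIndepOn F v I

theorem Represents.apply_eq_zero {v : α → V} {M : Matroid α} (h : Represents F v M) {e : α}
    (he : e ∉ M.E) : v e = 0 := by
  by_contra hne
  exact he (((h {e}).2 (LinearIndepOn.singleton hne)).subset_ground rfl)

theorem IsRepresentable.exists_represents {M : Matroid α} (h : IsRepresentable F M) :
    ∃ (r : ℕ) (v : α → Fin r → F), Represents F v M := by
  classical
  obtain ⟨r, P, hP⟩ := h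
  let v : α → Fin r → F := fun e => if h : e ∈ M.E then P.col ⟨e, h⟩ else 0
  have hcol : P.col = v ∘ Subtype.val := by
    ext e : 1
    simp [v]
  refine ⟨r, v, fun I => ?_⟩
  by_cases hI : I ⊆ M.E
  · have hIm : (fun e : M.E => (e : α)) '' {e : M.E | (e : α) ∈ I} = I := by
      ext x
      simpa using fun hx => hI hx
    rw [← hIm, hP, hcol]
    exact ⟨fun h => h.image_of_comp _ _, fun h => h.comp_of_image Subtype.val_injective.injOn⟩
  · refine iff_of_false (fun h => hI h.subset_ground) fun h => ?_
    obtain ⟨x, hx, hxE⟩ := Set.not_subset.1 hI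
    exact h.ne_zero hx (by simp [v, hxE])

theorem Represents.isRepresentable [FiniteDimensional F V] {v : α → V} {M : Matroid α}
    (h : Represents F v M) : IsRepresentable F M := by
  let b := Module.finBasis F V
  refine ⟨finrank F V, Matrix.of fun i e => b.equivFun (v e) i, fun I => ?_⟩
  rw [h]
  have hcol : (Matrix.of fun (i : Fin (finrank F V)) (e : M.E) => b.equivFun (v e) i).col =
      b.equivFun.toLinearMap ∘ v ∘ Subtype.val := rfl
  rw [hcol, LinearMap.linearIndepOn_iff_of_injOn _ b.equivFun.injective.injOn]
  exact ⟨fun h => h.comp_of_image Subtype.val_injective.injOn, fun h => h.image_of_comp _ _⟩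

theorem exists_matroid_represents {v : α → V} {E : Set α} (hE : E.Finite)
    (hv : ∀ e ∉ E, v e = 0) : ∃ M : Matroid α, M.E = E ∧ Represents F v M := by
  have hsub : ∀ I : Set α, LinearIndepOn F v I → I ⊆ E := by
    intro I hI x hx
    by_contra hn
    exact hI.ne_zero hx (hv x hn)
  refine ⟨(IndepMatroid.ofFinite hE (fun I => LinearIndepOn F v I) (linearIndepOn_empty F v)
    (fun I J hJ hIJ => hJ.mono hIJ) (fun I J hI hJ hlt => ?_) hsub).matroid, rfl,
    fun I => Iff.rfl⟩
  by_contra! hcon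
  -- If nothing in `J` augments `I`, then `v` maps `J` into the span of `I`, whose dimension is too
  -- small.
  have hle : J ⊆ {e | v e ∈ span F (v '' I)} := by
    intro e he
    by_contra hn
    exact (hcon e he) ((hI.notMem_span_iff.1 hn).2) ((hI.notMem_span_iff.1 hn).1)
  have := (hE.subset (hsub I hI)).fintype
  have := (hE.subset (hsub J hJ)).fintype
  have hrank : ∀ K : Set α, ∀ [Fintype K], LinearIndepOn F v K →
      finrank F (span F (v '' K)) = K.ncard := by
    intro K _ hK
    rw [Set.image_eq_range, finrank_span_eq_card hK, Set.ncard_eq_toFinset_card',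
      Set.toFinset_card]
  have : FiniteDimensional F (span F (v '' I)) :=
    FiniteDimensional.span_of_finite F ((Set.toFinite I).image v)
  have hfin := Submodule.finrank_mono (R := F) (span_le.2 (Set.image_subset_iff.2 hle))
  rw [hrank I hI, hrank J hJ] at hfin
  omega

/-- A basis `I` of `C` has the same span as `C`, and independence of `J` modulo it is independence
of `J ∪ I`. -/
theorem Represents.contract_indep_iff {v : α → V} {M : Matroid α} (h : Represents F v M)
    {C J : Set α} (hC : C ⊆ M.E) : (M.contract C).Indep J ↔
      Disjoint C J ∧ LinearIndepOn F ((span F (v '' C)).mkQ ∘ v) J := by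
  obtain ⟨I, hI⟩ := M.exists_isBasis C
  rw [hI.contract_indep_iff, and_comm]
  refine and_congr_right fun hd => ?_
  have hspan : span F (v '' C) = span F (v '' I) := by
    refine le_antisymm (span_le.2 ?_) (span_mono (Set.image_mono hI.subset))
    rintro _ ⟨e, he, rfl⟩
    by_contra hn
    have := ((h I).1 hI.indep).notMem_span_iff.1 hn
    exact this.2 (hI.mem_of_insert_indep he ((h _).2 this.1))
  rw [hspan, LinearIndepOn.quotient_iff_union ((h I).1 hI.indep)
    (hd.mono_left hI.subset), h, Set.union_comm]

end Representation

/-! ### Construction of the splice -/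

section Splice

variable {F V W α : Type*} [Field F] [AddCommGroup V] [Module F V] [AddCommGroup W] [Module F W]

theorem linearIndepOn_iff_of_relation_iff {v : α → V} {w : α → W} {I : Set α}
    (h : ∀ t : Finset α, (t : Set α) ⊆ I → ∀ a : α → F,
      ∑ i ∈ t, a i • v i = 0 ↔ ∑ i ∈ t, a i • w i = 0) :
    LinearIndepOn F v I ↔ LinearIndepOn F w I := by
  rw [linearIndepOn_iff', linearIndepOn_iff']
  exact forall_congr' fun t => forall_congr' fun a => forall_congr' fun ht => by rw [h t ht a]

theorem sum_smul_eq_sum_ite_smul [DecidableEq α] {x : α → V} {s t : Finset α}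
    (hx : ∀ i ∈ t, i ∉ s → x i = 0) (a : α → F) :
    ∑ i ∈ t, a i • x i = ∑ i ∈ s, (if i ∈ t then a i else 0) • x i := by
  simp only [ite_smul, zero_smul]
  rw [Finset.sum_ite_mem, Finset.inter_comm]
  refine (Finset.sum_subset Finset.inter_subset_left fun i hi hn => ?_).symm
  rw [hx i hi fun his => hn (Finset.mem_inter.2 ⟨hi, his⟩), smul_zero]

/-- Representations of `M` and `N` whose relations on the common elements agree, up to scaling,
after the other elements of `M` have been contracted, combine to a representation of a splice. -/
theorem exists_isSplice_of_represents [FiniteDimensional F V] [FiniteDimensional F W]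
    {M N : Matroid α} [M.Finite] [N.Finite] {v : α → V} {w : α → W}
    (hv : Represents F v M) (hw : Represents F w N) {s : Finset α}
    (hs : (s : Set α) = M.E ∩ N.E) (c : α → Fˣ)
    (hc : ∀ a : α → F, ∑ i ∈ s, a i • c i • w i = 0 ↔
      ∑ i ∈ s, a i • (span F (v '' (M.E \ N.E))).mkQ (v i) = 0) :
    ∃ L : Matroid α, IsSplice L M N ∧ IsRepresentable F L := by
  classical
  set Y := M.E \ N.E with hY
  set U := span F (v '' Y) with hU
  obtain ⟨g, hg⟩ := U.subtype.exists_leftInverse_of_injective U.ker_subtype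
  have hgU : ∀ x : U, g x = x := fun x => LinearMap.congr_fun hg x
  set z : α → U × W := fun e => (g (v e), c e • w e) with hz
  have hvz : ∀ e ∉ M.E, v e = 0 := fun e he => hv.apply_eq_zero he
  have hwz : ∀ e ∉ N.E, w e = 0 := fun e he => hw.apply_eq_zero he
  have hvU : ∀ e ∈ Y, v e ∈ U := fun e he => subset_span ⟨e, he, rfl⟩
  obtain ⟨L, hLE, hL⟩ := exists_matroid_represents (F := F) (v := z)
    (M.ground_finite.union N.ground_finite) (fun e he => by
      rw [Set.mem_union, not_or] at he
      simp [hz, hvz e he.1, hwz e he.2])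
  have hsum : ∀ (t : Finset α) (a : α → F), ∑ i ∈ t, a i • z i =
      (g (∑ i ∈ t, a i • v i), ∑ i ∈ t, a i • c i • w i) := by
    intro t a
    ext1 <;> simp [hz, Prod.fst_sum, Prod.snd_sum, map_sum]
  -- `w` vanishes on `Y` and `g` fixes U, so contracting `Y` forgets the first coordinate.
  have hspan : span F (z '' Y) = LinearMap.ker (LinearMap.snd F U W) := by
    refine le_antisymm (span_le.2 ?_) ?_
    · rintro _ ⟨e, he, rfl⟩
      simp [hz, hwz e he.2]
    · rintro ⟨⟨u, hu⟩, y⟩ hy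
      obtain rfl : y = 0 := hy
      induction hu using span_induction with
      | mem x hx =>
        obtain ⟨e, he, rfl⟩ := hx
        refine subset_span ⟨e, he, ?_⟩
        simp only [hz, hwz e he.2, smul_zero, Prod.mk.injEq, and_true]
        exact hgU ⟨v e, hvU e he⟩
      | zero => exact zero_mem _
      | add x y hx hy ihx ihy => simpa using add_mem ihx ihy
      | smul a x hx ih => simpa using smul_mem _ a ih
  refine ⟨L, ⟨hLE, ?_, ?_⟩, hL.isRepresentable⟩
  · refine Matroid.ext_indep rfl fun I hI => ?_
    rw [Matroid.restrict_ground_eq] at hI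
    rw [Matroid.restrict_indep_iff, and_iff_left hI, hL, hv]
    refine linearIndepOn_iff_of_relation_iff fun t ht a => ?_
    -- Elements of `Y` contribute zero to both sides, which leaves a relation on `s`. Once the sum
    -- of `v` lies in U, the first coordinate is that sum itself.
    have hrel : ∑ i ∈ t, a i • c i • w i = 0 ↔ U.mkQ (∑ i ∈ t, a i • v i) = 0 := by
      have hmem : ∀ i ∈ t, i ∉ s → i ∈ Y := by
        intro i hi his
        rw [← Finset.mem_coe, hs] at his
        exact ⟨hI (ht hi), fun h => his ⟨hI (ht hi), h⟩⟩
      simp only [map_sum, map_smul]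
      rw [sum_smul_eq_sum_ite_smul (s := s) fun i hi his => by
          rw [hwz i (hmem i hi his).2, smul_zero],
        sum_smul_eq_sum_ite_smul (s := s) (x := fun i => U.mkQ (v i)) fun i hi his => by
          simpa using hvU i (hmem i hi his)]
      exact hc _
    rw [hsum, Prod.mk_eq_zero, hrel]
    refine ⟨fun h => ?_, fun h => by simp [h]⟩
    have hm : ∑ i ∈ t, a i • v i ∈ U := by rw [← ker_mkQ U]; exact h.2
    have := (hgU ⟨_, hm⟩).symm.trans h.1
    simpa using congrArg Subtype.val this
  · have hLY : L.E \ N.E = Y := by rw [hLE, Set.union_sdiff_right]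
    have hYL : Y ⊆ L.E := hLY ▸ Set.sdiff_subset
    rw [contractTo, hLY]
    refine Matroid.ext_indep ?_ fun J hJ => ?_
    · rw [Matroid.contract_ground, hLE, hY]
      ext e
      simp only [Set.mem_sdiff, Set.mem_union]
      tauto
    rw [Matroid.contract_ground] at hJ
    rw [hL.contract_indep_iff hYL, and_iff_right (Set.disjoint_right.2 fun e he => (hJ he).2), hw,
      ← linearIndepOn_units_smul_iff (v := w) c]
    refine linearIndepOn_iff_of_relation_iff fun t _ a => ?_
    have : ∑ i ∈ t, a i • ((span F (z '' Y)).mkQ ∘ z) i =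
        (span F (z '' Y)).mkQ (∑ i ∈ t, a i • z i) := by simp
    rw [this, ← LinearMap.mem_ker, ker_mkQ, hspan, hsum, LinearMap.mem_ker, LinearMap.snd_apply]

theorem eq_zero_or_one_or_neg_one_of_card (hF : Nat.card F = 2 ∨ Nat.card F = 3) (x : F) :
    x = 0 ∨ x = 1 ∨ x = -1 := by
  have : Finite F := Nat.finite_of_card_ne_zero (by omega)
  have := Fintype.ofFinite F
  have hx := FiniteField.pow_card x
  rw [← Nat.card_eq_fintype_card] at hx
  rcases hF with h | h <;> rw [h] at hx
  · have : x * (x - 1) = 0 := by linear_combination hx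
    rcases mul_eq_zero.1 this with h0 | h1
    · exact Or.inl h0
    · exact Or.inr (Or.inl (sub_eq_zero.1 h1))
  · have : x * ((x - 1) * (x + 1)) = 0 := by linear_combination hx
    rcases mul_eq_zero.1 this with h0 | h1
    · exact Or.inl h0
    · exact Or.inr ((mul_eq_zero.1 h1).imp sub_eq_zero.1 eq_neg_of_add_eq_zero_left)

end Splice
end MatroidSplice

theorem proposition7p1 {α : Type*} {F : Type*} [Field F]
    (hF : Nat.card F = 2 ∨ Nat.card F = 3)
    (M N : Matroid α) [M.Finite] [N.Finite]
    (hMN : MatroidSplice.Matched M N)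
    (hM : MatroidSplice.IsRepresentable F M)
    (hN : MatroidSplice.IsRepresentable F N) :
    ∃ L : Matroid α, MatroidSplice.IsSplice L M N ∧ MatroidSplice.IsRepresentable F L := by
  obtain ⟨m, v, hv⟩ := hM.exists_represents
  obtain ⟨n, w, hw⟩ := hN.exists_represents
  obtain ⟨s, hs⟩ := (M.ground_finite.inter_of_left N.E).exists_finset_coe
  obtain ⟨c, hc⟩ := MatroidSplice.exists_units_forall_relation_iff
    (MatroidSplice.eq_zero_or_one_or_neg_one_of_card hF) (v := w)
    (w := (Submodule.span F (v '' (M.E \ N.E))).mkQ ∘ v) s (by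
      intro J hJ
      rw [hs] at hJ
      have hd : Disjoint (M.E \ N.E) J := Set.disjoint_left.2 fun e he heJ => he.2 (hJ heJ).2
      have h := congrArg (fun L : Matroid α => L.Indep J) hMN
      simp only [MatroidSplice.contractTo, Set.sdiff_self_inter, Matroid.restrict_indep_iff,
        eq_iff_iff] at h
      rw [hv.contract_indep_iff Set.sdiff_subset, and_iff_right hd, and_iff_left hJ, hw] at h
      exact h.symm)
  exact MatroidSplice.exists_isSplice_of_represents hv hw hs c hc
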